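/- Let $n,t,k$ be natural numbers with $n/2\le t\le k<n-1$. Consider $n$ asynchronous sequential processes $p_1,\dots,p_n$, of which up to $t$ may crash, that communicate through any number of arrays of single-writer multi-reader atomic registers (entry $i$ of an array is written only by $p_i$ and read by all) and any number of one-shot $k$-immediate snapshot ($k$-IS) objects. A $k$-IS object provides one operation $\mathsf{write\_snapshot}_k(u)$, which each process invokes at most once; an invocation by $p_i$ returns a set $view_i$ of pairs $\langle j,u_j\rangle$ such that, at all times: - (Self-inclusion) $view_i$ contains the pair $\langle i,u\rangle$ written by $p_i$; - (Validity) if $\langle j,u\rangle\in view_i$, then $p_j$ has invoked $\mathsf{write\_snapshot}_k(u)$; - (Containment) $view_i\subseteq view_j$ or $view_j\subseteq view_i$ for any two returned views; - (Immediacy) if $view_i$ and $view_j$ have been returned and $\langle i,u\rangle\in view_j$, then $view_i\subseteq view_j$; - (Output size) $|view_i|\ge n-k$; and moreover (Termination) if at least $n-k$ processes invoke the object in a run, then every invocation of it by a correct process returns. An algorithm implements consensus over a set $V$ of values in this model if, for all proposed values $v_1,\dots,v_n\in V$ and in every run with at most $t$ crashes, every correct process decides (termination), every decided value is one of the proposed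 values (validity), and no two decided values differ (agreement). Then, for every set $V$ with at least two elements, no algorithm (with arbitrary sets of local states, registers, register values, $k$-IS objects and values written to them) implements consensus over $V$ in this model. -/

import Mathlib

namespace CrashModel

/-- The next operation of a process whose local states form `S`, together with the local state that
follows, as a function of the value returned by the operation if there is one (local computation is
part of that function). Process `j` owns the entry `j` of every register array `r : R`. -/
inductive Op (n : ℕ) (V R W O U S : Type*) where
  /-- read the register owned by process `j` in the array `r` -/
  | read (r : R) (j : Fin n) (cont : W → S)
  /-- write `w` in the register that the executing process owns in the array `r` -/
  | write (r : R) (w : W) (cont : S)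
  /-- invoke `write_snapshot` with the value `u` on the snapshot object `o` -/
  | snapshot (o : O) (u : U) (cont : Finset (Fin n × U) → S)
  /-- decide `v`; the process may go on afterwards -/
  | decide (v : V) (cont : S)

/-- A deterministic algorithm for `n` sequential processes that propose and decide values in `V`.
The shared memory consists of arrays, indexed by `R`, of `n` single-writer multi-reader registers
with values in `W`, and of snapshot objects, indexed by `O`, to which values in `U` are written. -/
structure Algorithm (n : ℕ) (V R W O U S : Type*) where
  /-- initial value of every register -/
  regInit : R → Fin n → W
  /-- initial local state of a process, given the value it proposes -/
  init : Fin n → V → S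
  /-- the operation that a process executes next in a given local state -/
  next : Fin n → S → Op n V R W O U S

/-- A global state: local states, register contents, and for every snapshot object and every process
the value the process has written to it (`none` before the invocation) and the view it has obtained
from it (`none` before the response). -/
structure GlobalState (n : ℕ) (R W O U S : Type*) where
  loc : Fin n → S
  mem : R → Fin n → W
  inv : O → Fin n → Option U
  view : O → Fin n → Option (Finset (Fin n × U))

/-- What happens at one instant: nothing, process `i` executes its next operation (for a snapshot
object: its invocation), or process `i` obtains the view `X` as response to its pending
invocation. -/
inductive Event (n : ℕ) (U : Type*) where
  | idle
  | step (i : Fin n)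
  | respond (i : Fin n) (X : Finset (Fin n × U))

/-- The event is an event of process `i`. -/
def Event.IsBy {n : ℕ} {U : Type*} (i : Fin n) : Event n U → Prop
  | .idle => False
  | .step j => j = i
  | .respond j _ => j = i

/-- The safety properties of a one-shot `k`-immediate snapshot object among `n` processes, where
`inv i` is the value with which process `i` has invoked the object and `view i` is the view it has
obtained, if any. -/
structure IsKImmediateSnapshot {n : ℕ} {U : Type*} (k : ℕ) (inv : Fin n → Option U)
    (view : Fin n → Option (Finset (Fin n × U))) : Prop where
  self_inclusion : ∀ i X, view i = some X → ∃ u, inv i = some u ∧ (i, u) ∈ X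
  validity : ∀ i X, view i = some X → ∀ j u, (j, u) ∈ X → inv j = some u
  containment : ∀ i j X Y, view i = some X → view j = some Y → X ⊆ Y ∨ Y ⊆ X
  immediacy : ∀ i j X Y u, view i = some X → view j = some Y → (i, u) ∈ Y → X ⊆ Y
  output_size : ∀ i X, view i = some X → n ≤ X.card + k

namespace GlobalState

variable {n : ℕ} {R W O U S : Type*}

/-- Process `i` has invoked the object `o` and has not obtained its view yet. -/
def Inside (c : GlobalState n R W O U S) (i : Fin n) (o : O) : Prop :=
  c.inv o i ≠ none ∧ c.view o i = none

/-- Process `i` is waiting for a response of a snapshot object. -/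
def Waiting (c : GlobalState n R W O U S) (i : Fin n) : Prop :=
  ∃ o, c.Inside i o

end GlobalState

namespace Algorithm

variable {n : ℕ} {V R W O U S : Type*}

/-- The initial global state when process `i` proposes `input i`. -/
def initial (A : Algorithm n V R W O U S) (input : Fin n → V) : GlobalState n R W O U S where
  loc i := A.init i (input i)
  mem := A.regInit
  inv _ _ := none
  view _ _ := none

open Classical in
/-- `A.Trans c e c'`: the event `e` can lead from `c` to `c'`. The views are unconstrained here. -/
inductive Trans (A : Algorithm n V R W O U S) :
    GlobalState n R W O U S → Event n U → GlobalState n R W O U S → Prop where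
  | idle (c) : A.Trans c .idle c
  | read (c) (i : Fin n) (r : R) (j : Fin n) (cont : W → S)
      (hw : ¬ c.Waiting i) (hop : A.next i (c.loc i) = .read r j cont) :
      A.Trans c (.step i) { c with loc := Function.update c.loc i (cont (c.mem r j)) }
  | write (c) (i : Fin n) (r : R) (w : W) (cont : S)
      (hw : ¬ c.Waiting i) (hop : A.next i (c.loc i) = .write r w cont) :
      A.Trans c (.step i)
        { c with
          loc := Function.update c.loc i cont
          mem := Function.update c.mem r (Function.update (c.mem r) i w) }
  | decide (c) (i : Fin n) (v : V) (cont : S)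
      (hw : ¬ c.Waiting i) (hop : A.next i (c.loc i) = .decide v cont) :
      A.Trans c (.step i) { c with loc := Function.update c.loc i cont }
  | invoke (c) (i : Fin n) (o : O) (u : U) (cont : Finset (Fin n × U) → S)
      (hw : ¬ c.Waiting i) (hop : A.next i (c.loc i) = .snapshot o u cont)
      (hone : c.inv o i = none) :
      A.Trans c (.step i)
        { c with inv := Function.update c.inv o (Function.update (c.inv o) i (some u)) }
  | respond (c) (i : Fin n) (o : O) (u : U) (cont : Finset (Fin n × U) → S)
      (X : Finset (Fin n × U))
      (hin : c.Inside i o) (hop : A.next i (c.loc i) = .snapshot o u cont) :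
      A.Trans c (.respond i X)
        { c with
          loc := Function.update c.loc i (cont X)
          view := Function.update c.view o (Function.update (c.view o) i (some X)) }

/-- `c` and `e` are the global states and the events of an execution of `A` in which the snapshot
objects satisfy the safety properties of `k`-immediate snapshot at all times. -/
structure IsExecution (A : Algorithm n V R W O U S) (k : ℕ) (input : Fin n → V)
    (c : ℕ → GlobalState n R W O U S) (e : ℕ → Event n U) : Prop where
  start : c 0 = A.initial input
  trans : ∀ s, A.Trans (c s) (e s) (c (s + 1))
  safe : ∀ s o, IsKImmediateSnapshot k ((c s).inv o) ((c s).view o)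

/-- A run of `A` in the asynchronous model in which the processes of `faulty`, at most `t` many,
crash, enriched with `k`-immediate snapshot objects. -/
structure IsRun (A : Algorithm n V R W O U S) (t k : ℕ) (input : Fin n → V)
    (c : ℕ → GlobalState n R W O U S) (e : ℕ → Event n U) (faulty : Finset (Fin n)) : Prop
    extends A.IsExecution k input c e where
  card_faulty : faulty.card ≤ t
  /-- a faulty process stops at some time -/
  crash : ∀ i ∈ faulty, ∃ s, ∀ s', s ≤ s' → ¬ (e s').IsBy i
  /-- a correct process takes infinitely many steps, unless it waits forever for a response -/
  progress : ∀ i ∉ faulty, ∀ s, ∃ s', s ≤ s' ∧ ((e s').IsBy i ∨ (c s').Waiting i)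
  /-- Termination of the snapshot objects: if at least `n - k` processes invoke an object (without
  which no view of the required size exists), every invocation of it by a correct process
  returns. -/
  response : ∀ o, n ≤ {i | ∃ s, (c s).inv o i ≠ none}.ncard + k →
    ∀ i ∉ faulty, (∃ s, (c s).inv o i ≠ none) → ∃ s, (c s).view o i ≠ none

/-- No process ever attempts to invoke the same snapshot object a second time. -/
def OneShot (A : Algorithm n V R W O U S) (k : ℕ) : Prop :=
  ∀ input c e, A.IsExecution k input c e →
    ∀ s i o u cont, ¬ (c s).Waiting i → A.next i ((c s).loc i) = .snapshot o u cont →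
      (c s).inv o i = none

/-- Process `i` decides `v` at some time of the execution given by `c` and `e`. -/
def Decides (A : Algorithm n V R W O U S) (c : ℕ → GlobalState n R W O U S)
    (e : ℕ → Event n U) (i : Fin n) (v : V) : Prop :=
  ∃ s cont, e s = .step i ∧ A.next i ((c s).loc i) = .decide v cont

/-- `A` uses every snapshot object in the one-shot way and implements consensus in the `t`-crash
`n`-process read/write model enriched with `k`-immediate snapshot objects. -/
structure ImplementsConsensus (A : Algorithm n V R W O U S) (t k : ℕ) : Prop where
  one_shot : A.OneShot k
  termination : ∀ input c e faulty, A.IsRun t k input c e faulty →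
    ∀ i ∉ faulty, ∃ v, A.Decides c e i v
  validity : ∀ input c e faulty, A.IsRun t k input c e faulty →
    ∀ i v, A.Decides c e i v → ∃ j, v = input j
  agreement : ∀ input c e faulty, A.IsRun t k input c e faulty →
    ∀ i j v w, A.Decides c e i v → A.Decides c e j w → v = w

end Algorithm

end CrashModel

/-!
This is a bivalence argument in the style of Fischer, Lynch and Paterson. Let every snapshot object
assign views eagerly: as soon as `n - k` processes have invoked it, each pending invocation gets the
current set of invocations as its view. In addition, an adversary may replace views that are
assigned but not yet returned, for at most `t` processes. As these processes may crash, the states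
before and after such an interference have a possible decision in common. The first of two
invocations of the same object assigns views to at most `max 1 (n - k)` processes; since `1 ≤ t` and
`n ≤ t + k`, the adversary can turn both orders of the two invocations into the simultaneous
invocation. Any two other steps commute, or one of them matters only to the process that takes it.
Hence no single step can fix the decision, and from an initial state with an open decision there is
a fair run in which it stays open forever, contrary to termination.
-/

open Filter

namespace CrashModel

theorem exists_forall_mem_frequently_eq {ι : Type*} [Countable ι] {P : Set ι} (hP : P.Nonempty) :
    ∃ g : ℕ → ι, (∀ s, g s ∈ P) ∧ ∀ i ∈ P, ∃ᶠ s in atTop, g s = i := by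
  obtain ⟨e, rfl⟩ := P.to_countable.exists_eq_range hP
  refine ⟨fun s => e s.unpair.1, fun s => Set.mem_range_self _, ?_⟩
  rintro _ ⟨m, rfl⟩
  exact frequently_atTop.2 fun s => ⟨Nat.pair m s, Nat.right_le_pair m s, by simp⟩

theorem exists_hit_of_rank_lt {hit : ℕ → Prop} {j rank : ℕ → ℕ}
    (h : ∀ s, (hit s ∧ j (s + 1) = j s + 1) ∨ (j (s + 1) = j s ∧ rank (s + 1) < rank s))
    {s m : ℕ} (hm : j s ≤ m) : ∃ s', s ≤ s' ∧ hit s' ∧ j s' = m := by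
  have hs := h s
  by_cases hnow : hit s ∧ j s = m
  · exact ⟨s, le_rfl, hnow⟩
  · have hm' : j (s + 1) ≤ m := by grind
    obtain ⟨s', hle, hs'⟩ := exists_hit_of_rank_lt h hm'
    exact ⟨s', by omega, hs'⟩
termination_by (m - j s, rank s)
decreasing_by
  grind [Prod.Lex]

/-- A system with states in `α` in which every process `i : ι` takes deterministic steps, an
adversary may interfere with the state, and values in `V` are decided irrevocably. -/
structure DecisionSystem (α ι V : Type*) where
  step : ι → α → α
  adversary : α → α → Prop
  decided : α → Set V
  decided_subset_step : ∀ i x, decided x ⊆ decided (step i x)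
  decided_subset_of_adversary : ∀ x y, adversary x y → decided x ⊆ decided y

namespace DecisionSystem

variable {α ι V : Type*} {D : DecisionSystem α ι V} {x y z : α} {p : ι}

/-- The possible transitions, labelled by the process that takes a step, or by `none` for an
interference of the adversary. -/
inductive Move (D : DecisionSystem α ι V) : Option ι → α → α → Prop where
  | step (i : ι) (x : α) : D.Move (some i) x (D.step i x)
  | adversary {x y : α} (h : D.adversary x y) : D.Move none x y

/-- Reachability by finitely many moves. -/
def Reaches (D : DecisionSystem α ι V) : α → α → Prop :=
  Relation.ReflTransGen fun x y => ∃ l, D.Move l x y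

/-- Reachability by finitely many moves, none of which is a step of `p`. -/
def ReachesWithout (D : DecisionSystem α ι V) (p : ι) : α → α → Prop :=
  Relation.ReflTransGen fun x y => ∃ l, l ≠ some p ∧ D.Move l x y

/-- The valence of a state: the values that can still be decided from it on, or that have already
been decided. -/
def valence (D : DecisionSystem α ι V) (x : α) : Set V :=
  {v | ∃ y, D.Reaches x y ∧ v ∈ D.decided y}

/-- Two states that have a possible decision in common. -/
def Linked (D : DecisionSystem α ι V) (x y : α) : Prop :=
  (D.valence x ∩ D.valence y).Nonempty

theorem Move.reaches {l : Option ι} (h : D.Move l x y) : D.Reaches x y := .single ⟨l, h⟩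

theorem Move.eq_step {i : ι} (h : D.Move (some i) x y) : y = D.step i x := by
  cases h
  rfl

theorem Move.decided_subset {l : Option ι} (h : D.Move l x y) : D.decided x ⊆ D.decided y := by
  cases h with
  | step i => exact D.decided_subset_step i x
  | adversary h => exact D.decided_subset_of_adversary x y h

theorem Reaches.step (h : D.Reaches x y) (i : ι) : D.Reaches x (D.step i y) :=
  h.tail ⟨_, .step i y⟩

theorem Reaches.decided_subset (h : D.Reaches x y) : D.decided x ⊆ D.decided y := by
  induction h with
  | refl => exact subset_rfl
  | tail _ hmove ih => exact ih.trans hmove.choose_spec.decided_subset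

theorem Reaches.valence_subset (h : D.Reaches x y) : D.valence y ⊆ D.valence x :=
  fun _ ⟨z, hyz, hv⟩ => ⟨z, h.trans hyz, hv⟩

theorem Linked.symm (h : D.Linked x y) : D.Linked y x := by
  rwa [Linked, Set.inter_comm]

theorem Linked.of_reaches_left (h : D.Linked y z) (hxy : D.Reaches x y) : D.Linked x z :=
  h.mono (Set.inter_subset_inter_left _ hxy.valence_subset)

theorem Linked.valence_subset (h : D.Linked x y) (hy : (D.valence y).Subsingleton) :
    D.valence y ⊆ D.valence x := by
  obtain ⟨v, hvx, hvy⟩ := h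
  exact fun w hw => hy hw hvy ▸ hvx

theorem ReachesWithout.reaches (h : D.ReachesWithout p x y) : D.Reaches x y :=
  Relation.ReflTransGen.mono (fun _ _ ⟨l, _, hmove⟩ => ⟨l, hmove⟩) _ _ h

theorem Reaches.reachesWithout_or (h : D.Reaches x y) (p : ι) :
    D.ReachesWithout p x y ∨ ∃ z, D.ReachesWithout p x z ∧ D.Reaches (D.step p z) y := by
  induction h with
  | refl => exact .inl .refl
  | tail _ hmove ih =>
    rcases ih with hxy | ⟨z, hxz, hzy⟩
    · obtain ⟨l, hl⟩ := hmove
      by_cases hlp : l = some p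
      · subst hlp
        cases hl
        exact .inr ⟨_, hxy, .refl⟩
      · exact .inl (hxy.tail ⟨l, hlp, hl⟩)
    · exact .inr ⟨z, hxz, hzy.tail hmove⟩

theorem valence_subset_of_forall_reachesWithout
    (h : ∀ y, D.ReachesWithout p x y → D.valence (D.step p y) ⊆ D.valence (D.step p x)) :
    D.valence x ⊆ D.valence (D.step p x) := by
  rintro v ⟨z, hxz, hv⟩
  rcases hxz.reachesWithout_or p with hxz | ⟨y, hxy, hyz⟩
  · exact h z hxz ⟨_, .refl, D.decided_subset_step p z hv⟩
  · exact h y hxy ⟨z, hyz, hv⟩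

/-- If no step of `p` left the decision open, then, as long as `p` takes no step, the value that its
step would fix could never change. -/
theorem exists_valence_step_nontrivial
    (hlinked : ∀ y z l, D.Reaches x y → l ≠ some p → D.Move l y z →
      D.Linked (D.step p y) (D.step p z))
    (hx : (D.valence x).Nontrivial) :
    ∃ y, D.Reaches x y ∧ (D.valence (D.step p y)).Nontrivial := by
  by_contra! hfixed
  suffices h : ∀ y, D.ReachesWithout p x y → D.valence (D.step p y) ⊆ D.valence (D.step p x) from
    Set.not_nontrivial_iff.2 (hfixed x .refl) (hx.mono (valence_subset_of_forall_reachesWithout h))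
  intro y hxy
  induction hxy with
  | refl => exact subset_rfl
  | tail hxy hmove ih =>
    obtain ⟨l, hl, hmove⟩ := hmove
    have hlink := hlinked _ _ l (ReachesWithout.reaches hxy) hl hmove
    exact (hlink.valence_subset
      (hfixed _ ((ReachesWithout.reaches hxy).tail ⟨l, hmove⟩))).trans ih

/-- An infinite sequence of moves, in which the processes of `F` take finitely many steps and all
the other ones take infinitely many steps. -/
structure IsFairPath (D : DecisionSystem α ι V) (F : Finset ι) (f : ℕ → α) (l : ℕ → Option ι) :
    Prop where
  move : ∀ s, D.Move (l s) (f s) (f (s + 1))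
  crash : ∀ i ∈ F, ∀ᶠ s in atTop, l s ≠ some i
  fair : ∀ i ∉ F, ∃ᶠ s in atTop, l s = some i

section FairPath

variable {F : Finset ι} {f : ℕ → α} {l : ℕ → Option ι}

theorem IsFairPath.reaches (h : D.IsFairPath F f l) {r s : ℕ} (hrs : r ≤ s) :
    D.Reaches (f r) (f s) := by
  induction s, hrs using Nat.le_induction with
  | base => exact .refl
  | succ s _ ih => exact ih.tail ⟨_, h.move s⟩

theorem IsFairPath.cons (h : D.IsFairPath F f l) {m : Option ι} (hmove : D.Move m x (f 0)) :
    D.IsFairPath F (fun s => Nat.casesOn s x f) (fun s => Nat.casesOn s m l) where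
  move s := by
    cases s with
    | zero => exact hmove
    | succ s => exact h.move s
  crash i hi := by
    rw [← map_add_atTop_eq_nat 1]
    exact h.crash i hi
  fair i hi := by
    rw [← map_add_atTop_eq_nat 1]
    exact h.fair i hi

theorem Reaches.exists_isFairPath (h : D.Reaches x y) (hf : D.IsFairPath F f l) (h0 : f 0 = y) :
    ∃ f' l' N, f' 0 = x ∧ D.IsFairPath F f' l' ∧ ∀ s, f' (s + N) = f s := by
  induction h using Relation.ReflTransGen.head_induction_on with
  | refl => exact ⟨f, l, 0, h0, hf, fun _ => rfl⟩
  | @head x _ hmove _ ih =>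
    obtain ⟨m, hmove⟩ := hmove
    obtain ⟨f', l', N, rfl, hf', heq⟩ := ih
    exact ⟨_, _, N + 1, rfl, hf'.cons hmove, heq⟩

/-- The states that follow `x` if process `g s` takes a step at time `s`. -/
def follow (D : DecisionSystem α ι V) (g : ℕ → ι) (x : α) : ℕ → α
  | 0 => x
  | s + 1 => D.step (g s) (D.follow g x s)

theorem isFairPath_follow {g : ℕ → ι} (hmem : ∀ s, g s ∉ F)
    (hfair : ∀ i ∉ F, ∃ᶠ s in atTop, g s = i) (x : α) :
    D.IsFairPath F (D.follow g x) (fun s => some (g s)) where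
  move s := .step (g s) _
  crash i hi := .of_forall fun s hs => hmem s (Option.some.inj hs ▸ hi)
  fair i hi := by simpa only [Option.some.injEq] using hfair i hi

theorem reaches_follow (g : ℕ → ι) (x : α) (s : ℕ) : D.Reaches x (D.follow g x s) := by
  induction s with
  | zero => exact .refl
  | succ s ih => exact ih.step (g s)

/-- `D.StepsInto p B m x`: after `m` moves from `x`, a step of `p` can lead into `B`. -/
inductive StepsInto (D : DecisionSystem α ι V) (p : ι) (B : Set α) : ℕ → α → Prop where
  | now {x : α} (h : D.step p x ∈ B) : D.StepsInto p B 0 x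
  | later {m : ℕ} {l : Option ι} {x y : α} (hmove : D.Move l x y) (h : D.StepsInto p B m y) :
    D.StepsInto p B (m + 1) x

variable {B : Set α}

theorem Reaches.exists_stepsInto (h : D.Reaches x y) (hy : D.step p y ∈ B) :
    ∃ m, D.StepsInto p B m x := by
  induction h using Relation.ReflTransGen.head_induction_on with
  | refl => exact ⟨0, .now hy⟩
  | head hmove _ ih =>
    obtain ⟨m, hm⟩ := ih
    exact ⟨m + 1, .later hmove.choose_spec hm⟩

theorem StepsInto.exists_reaches {m : ℕ} (h : D.StepsInto p B m x) : ∃ y ∈ B, D.Reaches x y := by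
  induction h with
  | now h => exact ⟨_, h, (Move.step p _).reaches⟩
  | later hmove _ ih =>
    obtain ⟨y, hy, hreach⟩ := ih
    exact ⟨y, hy, .head ⟨_, hmove⟩ hreach⟩

/-- The least number of moves from `x` after which a step of `p` can lead into `B`, and `0` if there
is none. -/
noncomputable def distance (D : DecisionSystem α ι V) (B : Set α) (p : ι) (x : α) : ℕ :=
  sInf {m | D.StepsInto p B m x}

theorem exists_move_distance_lt
    (hB : ∀ x ∈ B, ∀ p, ∃ y, D.Reaches x y ∧ D.step p y ∈ B)
    (hx : ∃ y ∈ B, D.Reaches x y) (p : ι) :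
    ∃ l y, D.Move l x y ∧ (∃ z ∈ B, D.Reaches y z) ∧
      (l = some p ∨ D.distance B p y < D.distance B p x) := by
  obtain ⟨y, hy, hxy⟩ := hx
  obtain ⟨z, hyz, hz⟩ := hB y hy p
  have hdist : D.StepsInto p B (D.distance B p x) x :=
    Nat.sInf_mem (Reaches.exists_stepsInto (hxy.trans hyz) hz)
  generalize hd : D.distance B p x = d at hdist
  cases hdist with
  | now h => exact ⟨_, _, .step p x, ⟨_, h, .refl⟩, .inl rfl⟩
  | later hmove h =>
    exact ⟨_, _, hmove, h.exists_reaches, .inr (Nat.lt_succ_of_le (Nat.sInf_le h))⟩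

theorem exists_isFairPath_of_rank [Countable ι] [Nonempty ι] (rank : ι → α → ℕ) {L : Set α}
    (hL : ∀ x ∈ L, ∀ p, ∃ l y, D.Move l x y ∧ y ∈ L ∧ (l = some p ∨ rank p y < rank p x))
    (hx : x ∈ L) : ∃ f l, f 0 = x ∧ D.IsFairPath ∅ f l ∧ ∀ s, f s ∈ L := by
  classical
  obtain ⟨g, -, hg⟩ := exists_forall_mem_frequently_eq (P := (Set.univ : Set ι)) Set.univ_nonempty
  choose! label next hmove hmem hrank using hL
  let run : ℕ → α × ℕ := fun s => (fun q => (next q.1 (g q.2),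
    if label q.1 (g q.2) = some (g q.2) then q.2 + 1 else q.2))^[s] (x, 0)
  have hrun : ∀ s, run (s + 1) = (next (run s).1 (g (run s).2),
      if label (run s).1 (g (run s).2) = some (g (run s).2) then (run s).2 + 1 else (run s).2) :=
    fun s => Function.iterate_succ_apply' _ s _
  have hrunL : ∀ s, (run s).1 ∈ L := by
    intro s
    induction s with
    | zero => exact hx
    | succ s ih => rw [hrun]; exact hmem _ ih _
  refine ⟨fun s => (run s).1, fun s => label (run s).1 (g (run s).2), rfl, ⟨fun s => ?_, by simp,
    fun p _ => frequently_atTop.2 fun s => ?_⟩, hrunL⟩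
  · rw [hrun]
    exact hmove _ (hrunL s) _
  · obtain ⟨m, hm, rfl⟩ := frequently_atTop.1 (hg p trivial) (run s).2
    obtain ⟨s', hle, hhit, rfl⟩ := exists_hit_of_rank_lt
      (hit := fun s => label (run s).1 (g (run s).2) = some (g (run s).2))
      (j := fun s => (run s).2) (rank := fun s => rank (g (run s).2) (run s).1)
      (fun s => by have := hrank _ (hrunL s) (g (run s).2); rw [hrun]; grind) hm
    exact ⟨s', hle, hhit⟩

theorem exists_isFairPath_valence_nontrivial [Countable ι] [Nonempty ι]
    (hlinked : ∀ p y z l, D.Reaches x y → l ≠ some p → D.Move l y z →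
      D.Linked (D.step p y) (D.step p z))
    (hx : (D.valence x).Nontrivial) :
    ∃ f l, f 0 = x ∧ D.IsFairPath ∅ f l ∧ ∀ s, (D.valence (f s)).Nontrivial := by
  let B : Set α := {y | D.Reaches x y ∧ (D.valence y).Nontrivial}
  have hB : ∀ y ∈ B, ∀ p, ∃ z, D.Reaches y z ∧ D.step p z ∈ B := by
    rintro y ⟨hxy, hy⟩ p
    obtain ⟨z, hyz, hz⟩ := exists_valence_step_nontrivial
      (fun y' z l hy' => hlinked p y' z l (hxy.trans hy')) hy
    exact ⟨z, hyz, Reaches.step (hxy.trans hyz) p, hz⟩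
  obtain ⟨f, l, h0, hf, hL⟩ := exists_isFairPath_of_rank (D.distance B)
    (L := {y | ∃ z ∈ B, D.Reaches y z}) (fun y hy p => exists_move_distance_lt hB hy p)
    ⟨x, ⟨.refl, hx⟩, .refl⟩
  refine ⟨f, l, h0, hf, fun s => ?_⟩
  obtain ⟨z, ⟨-, hz⟩, hreach⟩ := hL s
  exact hz.mono hreach.valence_subset

end FairPath

end DecisionSystem

section Assignment

variable {n k : ℕ} {U : Type*} {inv inv' : Fin n → Option U}
  {a : Fin n → Option (Finset (Fin n × U))} {i : Fin n} {X : Finset (Fin n × U)}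

/-- The pairs of a process that has invoked a snapshot object and the value it has written, that is,
the largest view that the object can return. -/
def invocations (inv : Fin n → Option U) : Finset (Fin n × U) :=
  Finset.univ.filterMap (fun i => (inv i).map (Prod.mk i)) (by
    intro i j x hi hj
    simp only [Option.mem_def, Option.map_eq_some_iff] at hi hj
    obtain ⟨u, -, rfl⟩ := hi
    obtain ⟨w, -, h⟩ := hj
    exact (congrArg Prod.fst h).symm)

@[simp]
theorem mem_invocations {u : U} : (i, u) ∈ invocations inv ↔ inv i = some u := by
  simp [invocations]

theorem mem_image_fst_invocations :
    i ∈ (invocations inv).image Prod.fst ↔ inv i ≠ none := by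
  simp [Option.ne_none_iff_exists']

theorem ncard_le_card_invocations (inv : Fin n → Option U) :
    {i | inv i ≠ none}.ncard ≤ (invocations inv).card := by
  have himage : {i | inv i ≠ none} = ((invocations inv).image Prod.fst : Finset (Fin n)) := by
    ext i
    exact mem_image_fst_invocations.symm
  rw [himage, Set.ncard_coe_finset]
  exact Finset.card_image_le

theorem IsKImmediateSnapshot.mono {view : Fin n → Option (Finset (Fin n × U))}
    (ha : IsKImmediateSnapshot k inv a) (hle : ∀ i X, view i = some X → a i = some X) :
    IsKImmediateSnapshot k inv view where
  self_inclusion i X hX := ha.self_inclusion i X (hle i X hX)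
  validity i X hX := ha.validity i X (hle i X hX)
  containment i j X Y hX hY := ha.containment i j X Y (hle i X hX) (hle j Y hY)
  immediacy i j X Y u hX hY := ha.immediacy i j X Y u (hle i X hX) (hle j Y hY)
  output_size i X hX := ha.output_size i X (hle i X hX)

theorem IsKImmediateSnapshot.subset_invocations (ha : IsKImmediateSnapshot k inv a)
    (hX : a i = some X) : X ⊆ invocations inv :=
  fun ⟨j, u⟩ hj => mem_invocations.2 (ha.validity i X hX j u hj)

theorem invocations_mono (hle : ∀ i u, inv i = some u → inv' i = some u) :
    invocations inv ⊆ invocations inv' :=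
  fun ⟨i, u⟩ hi => mem_invocations.2 (hle i u (mem_invocations.1 hi))

/-- A choice of views for the invocations of a `k`-immediate snapshot object that are safe to return
and are determined for all invocations as soon as `n - k` processes have invoked the object. -/
structure IsPromptAssignment (k : ℕ) (inv : Fin n → Option U)
    (a : Fin n → Option (Finset (Fin n × U))) : Prop extends IsKImmediateSnapshot k inv a where
  prompt : n ≤ (invocations inv).card + k → ∀ i, inv i ≠ none → a i ≠ none

theorem isPromptAssignment_none :
    IsPromptAssignment k (fun _ : Fin n => (none : Option U)) (fun _ => none) where
  self_inclusion := by simp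
  validity := by simp
  containment := by simp
  immediacy := by simp
  output_size := by simp
  prompt := by simp

/-- The eager extension of the assignment `a`: every invocation without a view gets the set of all
invocations, if this set is large enough to be a view. -/
def assignViews (k : ℕ) (inv : Fin n → Option U) (a : Fin n → Option (Finset (Fin n × U)))
    (i : Fin n) : Option (Finset (Fin n × U)) :=
  (a i).or (if inv i ≠ none ∧ n ≤ (invocations inv).card + k then some (invocations inv) else none)

theorem assignViews_of_eq_some (hX : a i = some X) : assignViews k inv a i = some X := by
  simp [assignViews, hX]

theorem assignViews_of_invocation_eq_none (hi : inv i = none) : assignViews k inv a i = a i := by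
  simp [assignViews, hi]

theorem assignViews_eq_some : assignViews k inv a i = some X ↔
    a i = some X ∨ a i = none ∧ (inv i ≠ none ∧ n ≤ (invocations inv).card + k) ∧
      invocations inv = X := by
  simp [assignViews, Option.or_eq_some_iff]

theorem assignViews_congr {b : Fin n → Option (Finset (Fin n × U))} (h : a i = b i) :
    assignViews k inv a i = assignViews k inv b i := by
  simp only [assignViews, h]

theorem IsPromptAssignment.assignViews (h : IsPromptAssignment k inv a)
    (hle : ∀ i u, inv i = some u → inv' i = some u) :
    IsPromptAssignment k inv' (assignViews k inv' a) where
  self_inclusion i X hX := by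
    rcases assignViews_eq_some.1 hX with hX | ⟨-, ⟨hi, -⟩, rfl⟩
    · obtain ⟨u, hu, hm⟩ := h.self_inclusion i X hX
      exact ⟨u, hle _ _ hu, hm⟩
    · obtain ⟨u, hu⟩ := Option.ne_none_iff_exists'.1 hi
      exact ⟨u, hu, mem_invocations.2 hu⟩
  validity i X hX j u hj := by
    rcases assignViews_eq_some.1 hX with hX | ⟨-, -, rfl⟩
    · exact hle _ _ (h.validity i X hX j u hj)
    · exact mem_invocations.1 hj
  containment i j X Y hX hY := by
    have hsub := invocations_mono hle
    rcases assignViews_eq_some.1 hX with hX | ⟨-, -, rfl⟩ <;>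
      rcases assignViews_eq_some.1 hY with hY | ⟨-, -, rfl⟩
    · exact h.containment i j X Y hX hY
    · exact .inl ((h.subset_invocations hX).trans hsub)
    · exact .inr ((h.subset_invocations hY).trans hsub)
    · exact .inl subset_rfl
  immediacy i j X Y u hX hY hij := by
    rcases assignViews_eq_some.1 hY with hY | ⟨-, -, rfl⟩
    · have hcard : n ≤ (invocations inv).card + k := (h.output_size j Y hY).trans
        (Nat.add_le_add_right (Finset.card_le_card (h.subset_invocations hY)) k)
      have hi : inv i = some u := h.validity j Y hY i u hij
      obtain ⟨X', hX'⟩ := Option.ne_none_iff_exists'.1 (h.prompt hcard i (by simp [hi]))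
      rw [assignViews_of_eq_some hX', Option.some.injEq] at hX
      exact hX ▸ h.immediacy i j X' Y u hX' hY hij
    · rcases assignViews_eq_some.1 hX with hX | ⟨-, -, rfl⟩
      · exact (h.subset_invocations hX).trans (invocations_mono hle)
      · exact subset_rfl
  output_size i X hX := by
    rcases assignViews_eq_some.1 hX with hX | ⟨-, ⟨-, hcard⟩, rfl⟩
    · exact h.output_size i X hX
    · exact hcard
  prompt hcard i hi := by
    simp [CrashModel.assignViews, hi, hcard]

theorem card_invocations_update_le (p : Fin n) (u : U) :
    (invocations (Function.update inv p (some u))).card ≤ (invocations inv).card + 1 := by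
  classical
  refine (Finset.card_le_card fun ⟨i, w⟩ hi => ?_).trans (Finset.card_insert_le (p, u) _)
  rw [mem_invocations] at hi
  by_cases hip : i = p
  · subst hip
    simp_all
  · simp_all

/-- If the invocation of `p` is the one that makes the number of invocations reach `n - k`, then it
is the invoking processes that get a view; a later invocation concerns only `p` itself. -/
theorem IsPromptAssignment.exists_assignViews_eq (h : IsPromptAssignment k inv a) (p : Fin n)
    (u : U) : ∃ F : Finset (Fin n), F.card ≤ max 1 (n - k) ∧
      ∀ i ∉ F, CrashModel.assignViews k (Function.update inv p (some u)) a i = a i := by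
  by_cases hcard : n ≤ (invocations inv).card + k
  · refine ⟨{p}, by simp, fun i hi => ?_⟩
    have hip : i ≠ p := by simpa using hi
    by_cases hinv : inv i = none
    · exact assignViews_of_invocation_eq_none (by rwa [Function.update_of_ne hip])
    · obtain ⟨X, hX⟩ := Option.ne_none_iff_exists'.1 (h.prompt hcard i hinv)
      rw [hX, assignViews_of_eq_some hX]
  · refine ⟨(invocations (Function.update inv p (some u))).image Prod.fst, ?_, fun i hi =>
      assignViews_of_invocation_eq_none (by simpa using mt mem_image_fst_invocations.2 hi)⟩
    have hle := card_invocations_update_le (inv := inv) p u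
    exact Finset.card_image_le.trans (by omega)

end Assignment

theorem update_update_apply {ι κ β : Type*} [DecidableEq ι] [DecidableEq κ] (f : ι → κ → β)
    (o o' : ι) (i j : κ) (x : β) :
    Function.update f o (Function.update (f o) i x) o' j =
      if o' = o ∧ j = i then x else f o' j := by
  rcases eq_or_ne o' o with rfl | ho <;> rcases eq_or_ne j i with rfl | hj <;> simp [*]

/-- A global state, together with the views that the snapshot objects are going to return and the
values that each process has decided so far. -/
structure ScheduledState (n : ℕ) (V R W O U S : Type*) extends GlobalState n R W O U S where
  assigned : O → Fin n → Option (Finset (Fin n × U))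
  dec : Fin n → Set V

namespace ScheduledState

variable {n : ℕ} {V R W O U S : Type*} {F F' : Finset (Fin n)}
  {σ τ ρ : ScheduledState n V R W O U S}

/-- The two states look alike to all processes outside `F`. -/
structure Similar (F : Finset (Fin n)) (σ τ : ScheduledState n V R W O U S) : Prop where
  mem : σ.mem = τ.mem
  inv : σ.inv = τ.inv
  loc : ∀ i ∉ F, σ.loc i = τ.loc i
  view : ∀ i ∉ F, ∀ o, σ.view o i = τ.view o i
  assigned : ∀ i ∉ F, ∀ o, σ.assigned o i = τ.assigned o i
  dec : ∀ i ∉ F, σ.dec i = τ.dec i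

theorem Similar.refl (F : Finset (Fin n)) (σ : ScheduledState n V R W O U S) : Similar F σ σ := by
  constructor <;> simp

theorem Similar.symm (h : Similar F σ τ) : Similar F τ σ where
  mem := h.mem.symm
  inv := h.inv.symm
  loc i hi := (h.loc i hi).symm
  view i hi o := (h.view i hi o).symm
  assigned i hi o := (h.assigned i hi o).symm
  dec i hi := (h.dec i hi).symm

theorem Similar.trans (h : Similar F σ τ) (h' : Similar F τ ρ) : Similar F σ ρ where
  mem := h.mem.trans h'.mem
  inv := h.inv.trans h'.inv
  loc i hi := (h.loc i hi).trans (h'.loc i hi)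
  view i hi o := (h.view i hi o).trans (h'.view i hi o)
  assigned i hi o := (h.assigned i hi o).trans (h'.assigned i hi o)
  dec i hi := (h.dec i hi).trans (h'.dec i hi)

theorem Similar.mono (h : Similar F σ τ) (hF : F ⊆ F') : Similar F' σ τ where
  mem := h.mem
  inv := h.inv
  loc i hi := h.loc i (mt (@hF i) hi)
  view i hi := h.view i (mt (@hF i) hi)
  assigned i hi := h.assigned i (mt (@hF i) hi)
  dec i hi := h.dec i (mt (@hF i) hi)

open Classical in
/-- The state in which the invocations of the snapshot object `o` are those of `inv`. All the
invocations that are new in it happen simultaneously. -/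
noncomputable def withInvocations (k : ℕ) (o : O) (inv : Fin n → Option U)
    (σ : ScheduledState n V R W O U S) : ScheduledState n V R W O U S :=
  { σ with
    inv := Function.update σ.inv o inv
    assigned := Function.update σ.assigned o (assignViews k inv (σ.assigned o)) }

theorem Similar.withInvocations (h : Similar F σ τ) (k : ℕ) (o : O) (inv : Fin n → Option U) :
    Similar F (σ.withInvocations k o inv) (τ.withInvocations k o inv) where
  mem := h.mem
  inv := by simp only [ScheduledState.withInvocations, h.inv]
  loc := h.loc
  view := h.view
  assigned i hi o' := by
    by_cases ho : o' = o
    · subst ho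
      simpa [ScheduledState.withInvocations] using assignViews_congr (h.assigned i hi o')
    · simpa [ScheduledState.withInvocations, ho] using h.assigned i hi o'
  dec := h.dec

end ScheduledState

namespace Algorithm

open ScheduledState

variable {n : ℕ} {V R W O U S : Type*} {A : Algorithm n V R W O U S} {k : ℕ} {i j : Fin n}
  {σ τ : ScheduledState n V R W O U S} {F : Finset (Fin n)}

open Classical in
/-- The effect of a step of process `i`, which executes its next operation or obtains the view
assigned to its pending invocation. Views are assigned immediately at invocations. The step has no
effect if the pending invocation has no assigned view yet, or if the next operation would be a
second invocation of the same object. -/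
inductive Step (A : Algorithm n V R W O U S) (k : ℕ) (i : Fin n)
    (σ : ScheduledState n V R W O U S) : ScheduledState n V R W O U S → Prop where
  | read (r : R) (j : Fin n) (cont : W → S) (hop : A.next i (σ.loc i) = .read r j cont) :
      A.Step k i σ { σ with loc := Function.update σ.loc i (cont (σ.mem r j)) }
  | write (r : R) (w : W) (cont : S) (hop : A.next i (σ.loc i) = .write r w cont) :
      A.Step k i σ
        { σ with
          loc := Function.update σ.loc i cont
          mem := Function.update σ.mem r (Function.update (σ.mem r) i w) }
  | decide (v : V) (cont : S) (hop : A.next i (σ.loc i) = .decide v cont) :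
      A.Step k i σ
        { σ with
          loc := Function.update σ.loc i cont
          dec := Function.update σ.dec i (insert v (σ.dec i)) }
  | invoke (o : O) (u : U) (cont : Finset (Fin n × U) → S)
      (hop : A.next i (σ.loc i) = .snapshot o u cont) (hone : σ.inv o i = none) :
      A.Step k i σ (σ.withInvocations k o (Function.update (σ.inv o) i (some u)))
  | respond (o : O) (u : U) (cont : Finset (Fin n × U) → S) (X : Finset (Fin n × U))
      (hop : A.next i (σ.loc i) = .snapshot o u cont) (hin : σ.Inside i o)
      (hX : σ.assigned o i = some X) :
      A.Step k i σ
        { σ with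
          loc := Function.update σ.loc i (cont X)
          view := Function.update σ.view o (Function.update (σ.view o) i (some X)) }
  | blocked (o : O) (u : U) (cont : Finset (Fin n × U) → S)
      (hop : A.next i (σ.loc i) = .snapshot o u cont) (hinv : σ.inv o i ≠ none)
      (hblocked : σ.view o i ≠ none ∨ σ.assigned o i = none) :
      A.Step k i σ σ

theorem exists_step (A : Algorithm n V R W O U S) (k : ℕ) (i : Fin n)
    (σ : ScheduledState n V R W O U S) : ∃ τ, A.Step k i σ τ := by
  rcases hop : A.next i (σ.loc i) with ⟨r, j, cont⟩ | ⟨r, w, cont⟩ | ⟨o, u, cont⟩ | ⟨v, cont⟩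
  · exact ⟨_, .read r j cont hop⟩
  · exact ⟨_, .write r w cont hop⟩
  · by_cases hinv : σ.inv o i = none
    · exact ⟨_, .invoke o u cont hop hinv⟩
    · by_cases hblocked : σ.view o i ≠ none ∨ σ.assigned o i = none
      · exact ⟨_, .blocked o u cont hop hinv hblocked⟩
      · obtain ⟨hview, hX⟩ := not_or.1 hblocked
        obtain ⟨X, hX⟩ := Option.ne_none_iff_exists'.1 hX
        exact ⟨_, .respond o u cont X hop ⟨hinv, not_not.1 hview⟩ hX⟩
  · exact ⟨_, .decide v cont hop⟩

/-- The state after a step of process `i`. -/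
noncomputable def step (A : Algorithm n V R W O U S) (k : ℕ) (i : Fin n)
    (σ : ScheduledState n V R W O U S) : ScheduledState n V R W O U S :=
  (A.exists_step k i σ).choose

theorem step_spec (A : Algorithm n V R W O U S) (k : ℕ) (i : Fin n)
    (σ : ScheduledState n V R W O U S) : A.Step k i σ (A.step k i σ) :=
  (A.exists_step k i σ).choose_spec

theorem Step.unique {τ' : ScheduledState n V R W O U S} (h : A.Step k i σ τ)
    (h' : A.Step k i σ τ') : τ = τ' := by
  cases h <;> cases h' <;> simp_all [GlobalState.Inside]

theorem Step.step_eq (h : A.Step k i σ τ) : A.step k i σ = τ :=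
  (A.step_spec k i σ).unique h

theorem loc_step_of_ne (hj : j ≠ i) : (A.step k i σ).loc j = σ.loc j := by
  have h := A.step_spec k i σ
  generalize A.step k i σ = τ at h
  cases h <;> simp [withInvocations, hj]

theorem inv_step_of_ne (hj : j ≠ i) (o : O) : (A.step k i σ).inv o j = σ.inv o j := by
  have h := A.step_spec k i σ
  generalize A.step k i σ = τ at h
  cases h <;> simp [withInvocations, update_update_apply, hj]

/-- The next step of process `i` is a write or an invocation, the only steps that can make a
difference to other processes. -/
def IsVisible (A : Algorithm n V R W O U S) (i : Fin n) (σ : ScheduledState n V R W O U S) : Prop :=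
  (∃ r w cont, A.next i (σ.loc i) = .write r w cont) ∨
    ∃ o u cont, A.next i (σ.loc i) = .snapshot o u cont ∧ σ.inv o i = none

theorem isVisible_congr (hloc : σ.loc i = τ.loc i) (hinv : ∀ o, σ.inv o i = τ.inv o i) :
    A.IsVisible i σ ↔ A.IsVisible i τ := by
  simp only [IsVisible, hloc, hinv]

theorem not_isVisible_of_inv_ne_none {o : O} {u : U} {cont : Finset (Fin n × U) → S}
    (hop : A.next i (σ.loc i) = .snapshot o u cont) (hinv : σ.inv o i ≠ none) :
    ¬ A.IsVisible i σ := by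
  simpa [IsVisible, hop] using hinv

theorem Step.similar (h : A.Step k i σ τ) (hi : ¬ A.IsVisible i σ) : Similar {i} τ σ := by
  cases h with
  | write r w cont hop => exact absurd (.inl ⟨r, w, cont, hop⟩) hi
  | invoke o u cont hop hone => exact absurd (.inr ⟨o, u, cont, hop, hone⟩) hi
  | _ => constructor <;> simp +contextual [update_update_apply]

theorem similar_step (h : Similar F σ τ) (hi : σ.loc i = τ.loc i) :
    Similar F (A.step k i σ) (A.step k i τ) := by
  by_cases hF : i ∈ F ∧ ¬ A.IsVisible i σ
  · have hτ : ¬ A.IsVisible i τ := by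
      rw [← isVisible_congr hi fun o => by rw [h.inv]]
      exact hF.2
    have hsub : {i} ⊆ F := Finset.singleton_subset_iff.2 hF.1
    exact ((((A.step_spec k i σ).similar hF.2).mono hsub).trans h).trans
      (((A.step_spec k i τ).similar hτ).mono hsub).symm
  have hiF : A.IsVisible i σ ∨ i ∉ F := by tauto
  have hstep := A.step_spec k i σ
  generalize A.step k i σ = σ' at hstep
  cases hstep with
  | read r j cont hop =>
    rw [(Step.read r j cont (hi ▸ hop)).step_eq]
    constructor <;> simp +contextual [Function.update_apply, h.mem, h.inv, h.loc, h.view,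
      h.assigned, h.dec]
  | write r w cont hop =>
    rw [(Step.write r w cont (hi ▸ hop)).step_eq]
    constructor <;> simp +contextual [Function.update_apply, h.mem, h.inv, h.loc, h.view,
      h.assigned, h.dec]
  | decide v cont hop =>
    rw [(Step.decide v cont (hi ▸ hop)).step_eq]
    constructor <;> grind [Function.update_apply, h.mem, h.inv, h.loc, h.view, h.assigned, h.dec]
  | invoke o u cont hop hone =>
    rw [(Step.invoke o u cont (hi ▸ hop) (h.inv ▸ hone)).step_eq, h.inv]
    exact h.withInvocations k o _
  | respond o u cont X hop hin hX =>
    replace hiF := hiF.resolve_left (not_isVisible_of_inv_ne_none hop hin.1)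
    have hin' : τ.Inside i o := by rwa [GlobalState.Inside, ← h.inv, ← h.view i hiF]
    rw [(Step.respond o u cont X (hi ▸ hop) hin' (h.assigned i hiF o ▸ hX)).step_eq]
    constructor <;> simp +contextual [update_update_apply, Function.update_apply, h.mem, h.inv,
      h.loc, h.view, h.assigned, h.dec]
  | blocked o u cont hop hinv hblocked =>
    replace hiF := hiF.resolve_left (not_isVisible_of_inv_ne_none hop hinv)
    rw [(Step.blocked o u cont (hi ▸ hop) (h.inv ▸ hinv)
      (by rwa [← h.view i hiF, ← h.assigned i hiF])).step_eq]
    exact h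

/-- The assigned views are safe and comprise the returned ones, and a process that is waiting for a
response of a snapshot object cannot do anything else. -/
structure IsConsistent (A : Algorithm n V R W O U S) (k : ℕ) (σ : ScheduledState n V R W O U S) :
    Prop where
  assigned : ∀ o, IsPromptAssignment k (σ.inv o) (σ.assigned o)
  view : ∀ o i X, σ.view o i = some X → σ.assigned o i = some X
  inside : ∀ i o, σ.Inside i o → ∃ u cont, A.next i (σ.loc i) = .snapshot o u cont

theorem IsConsistent.safe (h : A.IsConsistent k σ) (o : O) :
    IsKImmediateSnapshot k (σ.inv o) (σ.view o) :=
  (h.assigned o).mono (h.view o)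

theorem IsConsistent.not_waiting (h : A.IsConsistent k σ)
    (hop : ∀ o u cont, A.next i (σ.loc i) = .snapshot o u cont → σ.inv o i = none) :
    ¬ σ.Waiting i := by
  rintro ⟨o, hin⟩
  obtain ⟨u, cont, hnext⟩ := h.inside i o hin
  exact hin.1 (hop o u cont hnext)

theorem IsConsistent.withInvocations (h : A.IsConsistent k σ) {o : O} {inv : Fin n → Option U}
    (hle : ∀ i u, σ.inv o i = some u → inv i = some u)
    (hnew : ∀ i, inv i ≠ none → σ.inv o i = none →
      ∃ u cont, A.next i (σ.loc i) = .snapshot o u cont) :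
    A.IsConsistent k (σ.withInvocations k o inv) where
  assigned o' := by
    rcases eq_or_ne o' o with rfl | ho
    · simpa [ScheduledState.withInvocations] using (h.assigned o').assignViews hle
    · simpa [ScheduledState.withInvocations, ho] using h.assigned o'
  view o' i X hX := by
    have hold := h.view o' i X hX
    rcases eq_or_ne o' o with rfl | ho
    · simpa [ScheduledState.withInvocations] using assignViews_of_eq_some hold
    · simpa [ScheduledState.withInvocations, ho] using hold
  inside i o' hin := by
    obtain ⟨hinv, hview⟩ := hin
    by_cases hold : σ.inv o' i = none
    · rcases eq_or_ne o' o with rfl | ho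
      · exact hnew i (by simpa [ScheduledState.withInvocations] using hinv) hold
      · simp [ScheduledState.withInvocations, ho, hold] at hinv
    · exact h.inside i o' ⟨hold, hview⟩

theorem IsConsistent.invoke (h : A.IsConsistent k σ) {o : O} {u : U}
    {cont : Finset (Fin n × U) → S} (hop : A.next i (σ.loc i) = .snapshot o u cont)
    (hone : σ.inv o i = none) :
    A.IsConsistent k (σ.withInvocations k o (Function.update (σ.inv o) i (some u))) := by
  refine h.withInvocations (fun j w hj => ?_) fun j hj hnone => ?_
  · rwa [Function.update_of_ne (by rintro rfl; simp [hone] at hj)]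
  · obtain rfl : j = i := by
      by_contra hji
      exact hj (by rwa [Function.update_of_ne hji])
    exact ⟨u, cont, hop⟩

theorem Step.isConsistent (h : A.Step k i σ τ) (hσ : A.IsConsistent k σ) : A.IsConsistent k τ := by
  cases h with
  | invoke o u cont hop hone => exact hσ.invoke hop hone
  | blocked => exact hσ
  | respond o u cont X hop hin hX =>
    refine ⟨hσ.assigned, fun o' j Y hY => ?_, fun j o' hj => ?_⟩
    · have := hσ.view o' j Y
      grind [update_update_apply]
    · have hσj := hσ.inside j o'
      simp only [GlobalState.Inside, update_update_apply] at hj hσj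
      grind [Function.update_apply]
  | _ =>
    refine ⟨hσ.assigned, hσ.view, fun j o' hj => ?_⟩
    obtain ⟨u, cont, hnext⟩ := hσ.inside j o' hj
    have hji : j ≠ i := by
      rintro rfl
      simp_all
    exact ⟨u, cont, by simpa [hji] using hnext⟩

theorem isConsistent_step (hσ : A.IsConsistent k σ) : A.IsConsistent k (A.step k i σ) :=
  (A.step_spec k i σ).isConsistent hσ

theorem dec_subset_dec_step (j : Fin n) : σ.dec j ⊆ (A.step k i σ).dec j := by
  have h := A.step_spec k i σ
  generalize A.step k i σ = τ at h
  cases h with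
  | decide v cont hop =>
    rcases eq_or_ne j i with rfl | hj
    · simp
    · simp [hj]
  | _ => exact subset_rfl

/-- The states `σ` and `τ` differ only in the views assigned to at most `t` processes. -/
structure Reassign (A : Algorithm n V R W O U S) (t k : ℕ) (σ τ : ScheduledState n V R W O U S) :
    Prop where
  toGlobalState_eq : τ.toGlobalState = σ.toGlobalState
  dec_eq : τ.dec = σ.dec
  isConsistent : A.IsConsistent k τ
  exists_similar : ∃ F : Finset (Fin n), F.card ≤ t ∧ Similar F σ τ

/-- The executions of `A` in which the snapshot objects assign views to pending invocations as early
as possible, except that an adversary can change the assigned views of at most `t` processes that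
have not obtained them yet. -/
noncomputable def system (A : Algorithm n V R W O U S) (t k : ℕ) :
    DecisionSystem (ScheduledState n V R W O U S) (Fin n) V where
  step := A.step k
  adversary := A.Reassign t k
  decided σ := ⋃ i, σ.dec i
  decided_subset_step _ _ := Set.iUnion_mono dec_subset_dec_step
  decided_subset_of_adversary _ _ h := by rw [h.dec_eq]

/-- The initial state when process `i` proposes `input i`. -/
def scheduledInitial (A : Algorithm n V R W O U S) (input : Fin n → V) :
    ScheduledState n V R W O U S where
  toGlobalState := A.initial input
  assigned _ _ := none
  dec _ := ∅

theorem isConsistent_scheduledInitial (input : Fin n → V) :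
    A.IsConsistent k (A.scheduledInitial input) where
  assigned _ := isPromptAssignment_none
  view _ _ _ hX := hX
  inside _ _ hin := absurd rfl hin.1

theorem isConsistent_of_move {t : ℕ} {l : Option (Fin n)} (h : (A.system t k).Move l σ τ)
    (hσ : A.IsConsistent k σ) : A.IsConsistent k τ := by
  cases h with
  | step => exact isConsistent_step hσ
  | adversary h => exact h.isConsistent

theorem isConsistent_of_reaches {t : ℕ} (h : (A.system t k).Reaches σ τ)
    (hσ : A.IsConsistent k σ) : A.IsConsistent k τ := by
  induction h with
  | refl => exact hσ
  | tail _ hmove ih => exact isConsistent_of_move hmove.choose_spec ih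

/-- The event `e` leads from `σ` to `τ` and is, unless it is idle, an event of the process `l`. If
it is idle, although it is the turn of a process, then this process is about to invoke a snapshot
object that it has already invoked. -/
structure Realizes (A : Algorithm n V R W O U S) (l : Option (Fin n))
    (σ τ : ScheduledState n V R W O U S) (e : Event n U) : Prop where
  trans : A.Trans σ.toGlobalState e τ.toGlobalState
  eq_of_isBy : ∀ i, e.IsBy i → l = some i
  isBy_or : ∀ i, l = some i → e.IsBy i ∨
    ∃ o u cont, A.next i (σ.loc i) = .snapshot o u cont ∧ σ.inv o i ≠ none
  mem_dec : ∀ i v, v ∈ τ.dec i ↔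
    (e = .step i ∧ ∃ cont, A.next i (σ.loc i) = .decide v cont) ∨ v ∈ σ.dec i

theorem Step.exists_realizes (h : A.Step k i σ τ) (hσ : A.IsConsistent k σ) :
    ∃ e, A.Realizes (some i) σ τ e := by
  cases h with
  | read r j cont hop =>
    exact ⟨.step i, .read _ i r j cont (hσ.not_waiting (by simp [hop])) hop,
      by simp [Event.IsBy], by simp [Event.IsBy], by grind⟩
  | write r w cont hop =>
    exact ⟨.step i, .write _ i r w cont (hσ.not_waiting (by simp [hop])) hop,
      by simp [Event.IsBy], by simp [Event.IsBy], by grind⟩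
  | decide v cont hop =>
    refine ⟨.step i, .decide _ i v cont (hσ.not_waiting (by simp [hop])) hop,
      by simp [Event.IsBy], by simp [Event.IsBy], fun j w => ?_⟩
    rcases eq_or_ne j i with rfl | hj
    · simp [hop, eq_comm]
    · simp [hj, hj.symm]
  | invoke o u cont hop hone =>
    have hw : ¬ σ.Waiting i := hσ.not_waiting (by grind)
    exact ⟨.step i, .invoke _ i o u cont hw hop hone, by simp [Event.IsBy],
      by simp [Event.IsBy], by grind [ScheduledState.withInvocations]⟩
  | respond o u cont X hop hin hX =>
    exact ⟨.respond i X, .respond _ i o u cont X hin hop,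
      by simp [Event.IsBy], by simp [Event.IsBy], by simp⟩
  | blocked o u cont hop hinv =>
    refine ⟨.idle, .idle _, by simp [Event.IsBy], fun j hj => .inr ?_, by simp⟩
    obtain rfl := Option.some.inj hj
    exact ⟨o, u, cont, hop, hinv⟩

theorem exists_realizes {t : ℕ} {l : Option (Fin n)} (h : (A.system t k).Move l σ τ)
    (hσ : A.IsConsistent k σ) : ∃ e, A.Realizes l σ τ e := by
  cases h with
  | step i => exact (A.step_spec k i σ).exists_realizes hσ
  | adversary h =>
    exact ⟨.idle, h.toGlobalState_eq ▸ .idle _, by simp [Event.IsBy], by simp, by simp [h.dec_eq]⟩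

theorem Trans.inv_ne_none {c c' : GlobalState n R W O U S} {e : Event n U} (h : A.Trans c e c')
    {o : O} (hinv : c.inv o i ≠ none) : c'.inv o i ≠ none := by
  cases h <;> grind [update_update_apply]

theorem IsExecution.eventually_inv_ne_none {input : Fin n → V} {c : ℕ → GlobalState n R W O U S}
    {e : ℕ → Event n U} (h : A.IsExecution k input c e) {o : O}
    (hinv : ∃ s, (c s).inv o i ≠ none) : ∀ᶠ s in atTop, (c s).inv o i ≠ none := by
  obtain ⟨s, hs⟩ := hinv
  filter_upwards [eventually_ge_atTop s] with s' hs'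
  induction s', hs' using Nat.le_induction with
  | base => exact hs
  | succ s' _ ih => exact (h.trans s').inv_ne_none ih

theorem IsConsistent.view_step_ne_none (hσ : A.IsConsistent k σ) {o : O}
    (hin : σ.Inside i o) (hX : σ.assigned o i ≠ none) : (A.step k i σ).view o i ≠ none := by
  obtain ⟨X, hX⟩ := Option.ne_none_iff_exists'.1 hX
  obtain ⟨u, cont, hop⟩ := hσ.inside i o hin
  simp [(Step.respond o u cont X hop hin hX).step_eq]

section Run

variable {t : ℕ} {f : ℕ → ScheduledState n V R W O U S} {l : ℕ → Option (Fin n)}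
  {input : Fin n → V} {e : ℕ → Event n U}

theorem isExecution_of_realizes (h0 : f 0 = A.scheduledInitial input)
    (hcons : ∀ s, A.IsConsistent k (f s)) (he : ∀ s, A.Realizes (l s) (f s) (f (s + 1)) (e s)) :
    A.IsExecution k input (fun s => (f s).toGlobalState) e where
  start := by simp only [h0, scheduledInitial]
  trans s := (he s).trans
  safe s := (hcons s).safe

theorem exists_view_ne_none (hexec : A.IsExecution k input (fun s => (f s).toGlobalState) e)
    (hf : (A.system t k).IsFairPath F f l) (hcons : ∀ s, A.IsConsistent k (f s)) {o : O}
    (hcard : n ≤ {i | ∃ s, (f s).inv o i ≠ none}.ncard + k) (hi : i ∉ F)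
    (hinv : ∃ s, (f s).inv o i ≠ none) : ∃ s, (f s).view o i ≠ none := by
  by_contra! hview
  have hall : ∀ᶠ s in atTop, ∀ j, (∃ s, (f s).inv o j ≠ none) → (f s).inv o j ≠ none :=
    eventually_all.2 fun j =>
      eventually_imp_distrib_left.2 fun hj => hexec.eventually_inv_ne_none hj
  obtain ⟨s, hs, hall⟩ := ((hf.fair i hi).and_eventually hall).exists
  have hassigned : (f s).assigned o i ≠ none := by
    refine ((hcons s).assigned o).prompt (hcard.trans (Nat.add_le_add_right ?_ k)) i (hall i hinv)
    exact (Set.ncard_le_ncard hall).trans (ncard_le_card_invocations _)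
  have hstep : f (s + 1) = A.step k i (f s) := (hs ▸ hf.move s).eq_step
  exact (hcons s).view_step_ne_none ⟨hall i hinv, hview s⟩ hassigned (hstep ▸ hview (s + 1))

theorem mem_dec_iff (h0 : f 0 = A.scheduledInitial input)
    (he : ∀ s, A.Realizes (l s) (f s) (f (s + 1)) (e s)) (i : Fin n) (v : V) :
    A.Decides (fun s => (f s).toGlobalState) e i v ↔ ∃ s, v ∈ (f s).dec i := by
  constructor
  · rintro ⟨s, cont, hes, hop⟩
    exact ⟨s + 1, ((he s).mem_dec i v).2 (.inl ⟨hes, cont, hop⟩)⟩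
  · rintro ⟨s, hs⟩
    induction s with
    | zero => simp [h0, scheduledInitial] at hs
    | succ s ih =>
      rcases ((he s).mem_dec i v).1 hs with ⟨hes, cont, hop⟩ | hold
      · exact ⟨s, cont, hes, hop⟩
      · exact ih hold

theorem exists_isRun (hone : A.OneShot k) (hF : F.card ≤ t) (h0 : f 0 = A.scheduledInitial input)
    (hf : (A.system t k).IsFairPath F f l) :
    ∃ e, A.IsRun t k input (fun s => (f s).toGlobalState) e F ∧
      ∀ i v, A.Decides (fun s => (f s).toGlobalState) e i v ↔ ∃ s, v ∈ (f s).dec i := by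
  have hcons : ∀ s, A.IsConsistent k (f s) := fun s =>
    isConsistent_of_reaches (hf.reaches s.zero_le) (h0 ▸ isConsistent_scheduledInitial input)
  choose e he using fun s => exists_realizes (hf.move s) (hcons s)
  have hexec := isExecution_of_realizes h0 hcons he
  refine ⟨e, ⟨hexec, hF, fun i hi => ?_, fun i hi s => ?_, fun o hcard i hi hinv =>
    exists_view_ne_none hexec hf hcons hcard hi hinv⟩, mem_dec_iff h0 he⟩
  · obtain ⟨s, hs⟩ := eventually_atTop.1 (hf.crash i hi)
    exact ⟨s, fun s' hs' hby => hs s' hs' ((he s').eq_of_isBy i hby)⟩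
  · obtain ⟨s', hs', hl⟩ := frequently_atTop.1 (hf.fair i hi) s
    refine ⟨s', hs', ((he s').isBy_or i hl).imp_right ?_⟩
    rintro ⟨o, u, cont, hop, hinv⟩
    by_contra hw
    exact hinv (hone input _ e hexec s' i o u cont hw hop)

end Run

section Consensus

variable {t : ℕ} {input input' : Fin n → V}

theorem dec_subset_of_reaches (h : (A.system t k).Reaches σ τ) (i : Fin n) :
    σ.dec i ⊆ τ.dec i := by
  induction h with
  | refl => exact subset_rfl
  | tail _ hmove ih =>
    obtain ⟨l, hmove⟩ := hmove
    cases hmove with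
    | step => exact ih.trans (dec_subset_dec_step i)
    | adversary h => rwa [h.dec_eq]

theorem exists_isRun_of_reaches (hone : A.OneShot k) {f : ℕ → ScheduledState n V R W O U S}
    {l : ℕ → Option (Fin n)} (hf : (A.system t k).IsFairPath F f l) (hF : F.card ≤ t)
    (h0 : (A.system t k).Reaches (A.scheduledInitial input) (f 0)) :
    ∃ c e, A.IsRun t k input c e F ∧ ∀ i v, A.Decides c e i v ↔ ∃ s, v ∈ (f s).dec i := by
  obtain ⟨f', l', N, hf0', hf', heq⟩ := h0.exists_isFairPath hf rfl
  obtain ⟨e, hrun, hdec⟩ := exists_isRun hone hF hf0' hf'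
  refine ⟨_, e, hrun, fun i v => (hdec i v).trans ⟨?_, fun ⟨s, hs⟩ => ⟨s + N, by rwa [heq]⟩⟩⟩
  rintro ⟨s, hs⟩
  exact ⟨s, heq s ▸ dec_subset_of_reaches (hf'.reaches (Nat.le_add_right s N)) i hs⟩

theorem exists_isRun_follow (hone : A.OneShot k)
    (hσ : (A.system t k).Reaches (A.scheduledInitial input) σ) (hF : F.card ≤ t)
    {g : ℕ → Fin n} (hmem : ∀ s, g s ∉ F) (hfair : ∀ i ∉ F, ∃ᶠ s in atTop, g s = i) :
    ∃ c e, A.IsRun t k input c e F ∧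
      ∀ i v, A.Decides c e i v ↔ ∃ s, v ∈ ((A.system t k).follow g σ s).dec i :=
  exists_isRun_of_reaches hone (DecisionSystem.isFairPath_follow hmem hfair σ) hF hσ

theorem exists_schedule (hF : F.card < n) :
    ∃ g : ℕ → Fin n, (∀ s, g s ∉ F) ∧ ∀ i ∉ F, ∃ᶠ s in atTop, g s = i := by
  obtain ⟨i, hi⟩ : ∃ i, i ∉ F := by
    by_contra! h
    simp [Finset.eq_univ_of_forall h] at hF
  exact exists_forall_mem_frequently_eq (P := {i | i ∉ F}) ⟨i, hi⟩

namespace ImplementsConsensus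

variable (hA : A.ImplementsConsensus t k)
include hA

theorem exists_isRun_decides (hn : 0 < n)
    (hσ : (A.system t k).Reaches (A.scheduledInitial input) σ) :
    ∃ c e, A.IsRun t k input c e ∅ ∧ ∀ i, ∀ v ∈ σ.dec i, A.Decides c e i v := by
  obtain ⟨g, hmem, hfair⟩ := exists_schedule (F := ∅) hn
  obtain ⟨c, e, hrun, hdec⟩ :=
    exists_isRun_follow hA.one_shot hσ (F := ∅) (Nat.zero_le t) hmem hfair
  exact ⟨c, e, hrun, fun i v hv => (hdec i v).2 ⟨0, hv⟩⟩

theorem decided_subset_range (hσ : (A.system t k).Reaches (A.scheduledInitial input) σ) :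
    (A.system t k).decided σ ⊆ Set.range input := by
  intro v hv
  obtain ⟨i, hv⟩ := Set.mem_iUnion.1 hv
  obtain ⟨c, e, hrun, hdec⟩ := hA.exists_isRun_decides i.pos hσ
  obtain ⟨j, rfl⟩ := hA.validity input c e ∅ hrun i v (hdec i v hv)
  exact ⟨j, rfl⟩

theorem decided_subsingleton (hσ : (A.system t k).Reaches (A.scheduledInitial input) σ) :
    ((A.system t k).decided σ).Subsingleton := by
  intro v hv w hw
  obtain ⟨i, hv⟩ := Set.mem_iUnion.1 hv
  obtain ⟨j, hw⟩ := Set.mem_iUnion.1 hw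
  obtain ⟨c, e, hrun, hdec⟩ := hA.exists_isRun_decides i.pos hσ
  exact hA.agreement input c e ∅ hrun i j v w (hdec i v hv) (hdec j w hw)

theorem valence_subset_range (input : Fin n → V) :
    (A.system t k).valence (A.scheduledInitial input) ⊆ Set.range input :=
  fun _ ⟨_, hreach, hv⟩ => hA.decided_subset_range hreach hv

theorem decided_eq_empty (hσ : (A.system t k).Reaches (A.scheduledInitial input) σ)
    (hval : ((A.system t k).valence σ).Nontrivial) : (A.system t k).decided σ = ∅ := by
  by_contra hne
  obtain ⟨v, hv⟩ := Set.nonempty_iff_ne_empty.2 hne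
  obtain ⟨w, ⟨τ, hστ, hw⟩, hwv⟩ := hval.exists_ne v
  exact hwv (hA.decided_subsingleton (hσ.trans hστ) hw (hστ.decided_subset hv))

/-- Crashing the processes of `F`, all the others run in the same way from both states, up to their
decisions. -/
theorem linked_of_similar (htn : t < n)
    (hσ : (A.system t k).Reaches (A.scheduledInitial input) σ)
    (h : Similar F σ τ) (hF : F.card ≤ t) : (A.system t k).Linked σ τ := by
  obtain ⟨g, hmem, hfair⟩ := exists_schedule (hF.trans_lt htn)
  have hsim : ∀ s, Similar F ((A.system t k).follow g σ s) ((A.system t k).follow g τ s) := by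
    intro s
    induction s with
    | zero => exact h
    | succ s ih => exact similar_step ih (ih.loc _ (hmem s))
  obtain ⟨c, e, hrun, hdec⟩ := exists_isRun_follow hA.one_shot hσ hF hmem hfair
  obtain ⟨v, hv⟩ := hA.termination input c e F hrun (g 0) (hmem 0)
  obtain ⟨s, hs⟩ := (hdec (g 0) v).1 hv
  exact ⟨v, ⟨_, DecisionSystem.reaches_follow g σ s, Set.mem_iUnion.2 ⟨_, hs⟩⟩,
    ⟨_, DecisionSystem.reaches_follow g τ s,
      Set.mem_iUnion.2 ⟨_, (hsim s).dec (g 0) (hmem 0) ▸ hs⟩⟩⟩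

theorem linked_of_reaches_common {ρ : ScheduledState n V R W O U S} (htn : t < n)
    (hσ : (A.system t k).Reaches (A.scheduledInitial input) σ)
    (hσρ : (A.system t k).Reaches σ ρ) (hτρ : (A.system t k).Reaches τ ρ) :
    (A.system t k).Linked σ τ :=
  have hlinked := hA.linked_of_similar htn (hσ.trans hσρ) (.refl ∅ ρ) (Nat.zero_le t)
  ((hlinked.of_reaches_left hτρ).symm).of_reaches_left hσρ

end ImplementsConsensus

section Commute

variable {p q : Fin n}

theorem isVisible_step (hpq : p ≠ q) : A.IsVisible p (A.step k q σ) ↔ A.IsVisible p σ :=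
  isVisible_congr (loc_step_of_ne hpq) (inv_step_of_ne hpq)

theorem step_comm_of_write (hpq : p ≠ q) {r : R} {w : W} {cont : S}
    (hp : A.next p (σ.loc p) = .write r w cont) (hq : A.IsVisible q σ) :
    A.step k q (A.step k p σ) = A.step k p (A.step k q σ) := by
  have hp' : A.next p ((A.step k q σ).loc p) = .write r w cont := by rwa [loc_step_of_ne hpq]
  obtain ⟨r', w', cont', hop⟩ | ⟨o, u, cont', hop, hinv⟩ := (isVisible_step hpq.symm).2 hq
  · have hop' : A.next q (σ.loc q) = .write r' w' cont' := by rwa [← loc_step_of_ne hpq.symm]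
    rw [(Step.write r w cont hp').step_eq, (Step.write r' w' cont' hop').step_eq,
      (Step.write r' w' cont' hop).step_eq, (Step.write r w cont hp).step_eq,
      ScheduledState.mk.injEq, GlobalState.mk.injEq]
    refine ⟨⟨Function.update_comm hpq .., ?_, rfl, rfl⟩, rfl, rfl⟩
    ext r'' j
    grind [update_update_apply]
  · have hop' : A.next q (σ.loc q) = .snapshot o u cont' := by rwa [← loc_step_of_ne hpq.symm]
    have hinv' : σ.inv o q = none := by rwa [← inv_step_of_ne hpq.symm]
    rw [(Step.write r w cont hp').step_eq, (Step.invoke o u cont' hop' hinv').step_eq,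
      (Step.invoke o u cont' hop hinv).step_eq, (Step.write r w cont hp).step_eq]
    rfl

theorem step_comm_of_ne (hpq : p ≠ q) {o o' : O} (ho : o ≠ o') {u w : U}
    {cont cont' : Finset (Fin n × U) → S}
    (hp : A.next p (σ.loc p) = .snapshot o u cont) (hpinv : σ.inv o p = none)
    (hq : A.next q (σ.loc q) = .snapshot o' w cont') (hqinv : σ.inv o' q = none) :
    A.step k q (A.step k p σ) = A.step k p (A.step k q σ) := by
  have hp' : A.next p ((A.step k q σ).loc p) = .snapshot o u cont := by rwa [loc_step_of_ne hpq]
  have hpinv' : (A.step k q σ).inv o p = none := by rwa [inv_step_of_ne hpq]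
  have hq' : A.next q ((A.step k p σ).loc q) = .snapshot o' w cont' := by
    rwa [loc_step_of_ne hpq.symm]
  have hqinv' : (A.step k p σ).inv o' q = none := by rwa [inv_step_of_ne hpq.symm]
  rw [(Step.invoke o u cont hp' hpinv').step_eq, (Step.invoke o' w cont' hq' hqinv').step_eq,
    (Step.invoke o u cont hp hpinv).step_eq, (Step.invoke o' w cont' hq hqinv).step_eq]
  classical
  simp only [withInvocations, Function.update_of_ne ho, Function.update_of_ne ho.symm,
    Function.update_comm ho]

theorem reassign_withInvocations {t : ℕ} {o : O} {inv inv' : Fin n → Option U}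
    (hF : F.card ≤ t) (hassign : ∀ i ∉ F, assignViews k inv (σ.assigned o) i = σ.assigned o i)
    (hcons : A.IsConsistent k (σ.withInvocations k o inv')) :
    A.Reassign t k ((σ.withInvocations k o inv).withInvocations k o inv')
      (σ.withInvocations k o inv') where
  toGlobalState_eq := by simp [withInvocations]
  dec_eq := rfl
  isConsistent := hcons
  exists_similar := by
    refine ⟨F, hF, rfl, by simp [withInvocations], fun _ _ => rfl, fun _ _ _ => rfl,
      fun i hi o' => ?_, fun _ _ => rfl⟩
    rcases eq_or_ne o' o with rfl | ho
    · simpa [withInvocations] using assignViews_congr (hassign i hi)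
    · simp [withInvocations, ho]

/-- The order of the two invocations shows only in the views assigned by the first one. They belong
to at most `max 1 (n - k) ≤ t` processes, so that the adversary may replace them. -/
theorem reassign_step_step {t : ℕ} (ht : 1 ≤ t) (hkt : n ≤ t + k) (hσ : A.IsConsistent k σ)
    (hpq : p ≠ q) {o : O} {u w : U} {cont cont' : Finset (Fin n × U) → S}
    (hp : A.next p (σ.loc p) = .snapshot o u cont) (hpinv : σ.inv o p = none)
    (hq : A.next q (σ.loc q) = .snapshot o w cont') (hqinv : σ.inv o q = none) :
    A.Reassign t k (A.step k q (A.step k p σ)) (σ.withInvocations k o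
      (Function.update (Function.update (σ.inv o) p (some u)) q (some w))) := by
  have hq' : A.next q ((A.step k p σ).loc q) = .snapshot o w cont' := by
    rwa [loc_step_of_ne hpq.symm]
  have hqinv' : (A.step k p σ).inv o q = none := by rwa [inv_step_of_ne hpq.symm]
  rw [(Step.invoke o w cont' hq' hqinv').step_eq, (Step.invoke o u cont hp hpinv).step_eq]
  obtain ⟨F, hF, hassign⟩ := (hσ.assigned o).exists_assignViews_eq p u
  have hinv : (σ.withInvocations k o (Function.update (σ.inv o) p (some u))).inv o =
      Function.update (σ.inv o) p (some u) := by simp [withInvocations]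
  rw [hinv]
  refine reassign_withInvocations (hF.trans (by omega)) hassign
    (hσ.withInvocations (fun i x hi => ?_) fun i hi hnone => ?_) <;>
  grind [Function.update_apply]

end Commute

namespace ImplementsConsensus

variable (hA : A.ImplementsConsensus t k) {p q : Fin n}
include hA

theorem linked_step_step (ht : 1 ≤ t) (htn : t < n) (hkt : n ≤ t + k)
    (hσ : (A.system t k).Reaches (A.scheduledInitial input) σ) (hpq : p ≠ q) :
    (A.system t k).Linked (A.step k p σ) (A.step k p (A.step k q σ)) := by
  have hpσ := hσ.step p
  have hqp : (A.system t k).Reaches (A.step k p σ) (A.step k q (A.step k p σ)) :=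
    (DecisionSystem.Move.step q _).reaches
  by_cases hq : A.IsVisible q σ
  swap
  · have hsim : Similar {q} (A.step k p σ) (A.step k p (A.step k q σ)) :=
      similar_step ((A.step_spec k q σ).similar hq).symm (loc_step_of_ne hpq).symm
    exact hA.linked_of_similar htn hpσ hsim (by simpa using ht)
  by_cases hp : A.IsVisible p σ
  swap
  · have hsim : Similar {p} (A.step k q (A.step k p σ)) (A.step k q σ) :=
      similar_step ((A.step_spec k p σ).similar hp) (loc_step_of_ne hpq.symm)
    have hsim' : Similar {p} (A.step k p (A.step k q σ)) (A.step k q σ) :=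
      (A.step_spec k p _).similar (mt (isVisible_step hpq).1 hp)
    exact (hA.linked_of_similar htn (hpσ.step q) (hsim.trans hsim'.symm)
      (by simpa using ht)).of_reaches_left hqp
  have hcomm (h : A.step k q (A.step k p σ) = A.step k p (A.step k q σ)) :
      (A.system t k).Linked (A.step k p σ) (A.step k p (A.step k q σ)) :=
    hA.linked_of_reaches_common htn hpσ hqp (h ▸ .refl)
  obtain ⟨r, w, cont, hpop⟩ | ⟨o, u, cont, hpop, hpinv⟩ := hp
  · exact hcomm (step_comm_of_write hpq hpop hq)
  obtain ⟨r, w, cont', hqop⟩ | ⟨o', w, cont', hqop, hqinv⟩ := id hq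
  · exact hcomm (step_comm_of_write hpq.symm hqop (.inr ⟨o, u, cont, hpop, hpinv⟩)).symm
  by_cases ho : o = o'
  · subst ho
    have hcons := isConsistent_of_reaches hσ (isConsistent_scheduledInitial input)
    have hpq' := reassign_step_step ht hkt hcons hpq hpop hpinv hqop hqinv
    have hqp' := reassign_step_step ht hkt hcons hpq.symm hqop hqinv hpop hpinv
    rw [Function.update_comm hpq.symm] at hqp'
    exact hA.linked_of_reaches_common htn hpσ
      (hqp.trans (DecisionSystem.Move.adversary hpq').reaches)
      (DecisionSystem.Move.adversary hqp').reaches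
  · exact hcomm (step_comm_of_ne hpq ho hpop hpinv hqop hqinv)

theorem linked_step_of_move (ht : 1 ≤ t) (htn : t < n) (hkt : n ≤ t + k)
    (hσ : (A.system t k).Reaches (A.scheduledInitial input) σ) {l : Option (Fin n)}
    (hl : l ≠ some p) (hmove : (A.system t k).Move l σ τ) :
    (A.system t k).Linked (A.step k p σ) (A.step k p τ) := by
  cases hmove with
  | step q => exact hA.linked_step_step ht htn hkt hσ (by simpa [eq_comm] using hl)
  | adversary h =>
    obtain ⟨F, hF, hsim⟩ := h.exists_similar
    exact hA.linked_of_similar htn (hσ.step p)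
      (similar_step hsim (by rw [h.toGlobalState_eq])) hF

theorem linked_scheduledInitial_update (ht : 1 ≤ t) (htn : t < n) (input : Fin n → V) (i : Fin n)
    (v : V) : (A.system t k).Linked (A.scheduledInitial (Function.update input i v))
      (A.scheduledInitial input) := by
  refine hA.linked_of_similar (F := {i}) htn .refl ?_ (by simpa using ht)
  constructor <;> simp +contextual [scheduledInitial, initial]

/-- Let the processes change their proposals from `v` to `w` one at a time: as long as the decision
is determined by the proposals, it cannot change. -/
theorem exists_valence_nontrivial [Nontrivial V] (ht : 1 ≤ t) (htn : t < n) :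
    ∃ input, ((A.system t k).valence (A.scheduledInitial input)).Nontrivial := by
  obtain ⟨v, w, hvw⟩ := exists_pair_ne V
  by_contra! hfixed
  have hconst {x y : V} (hy : y ∈ (A.system t k).valence (A.scheduledInitial fun _ => x)) :
      x = y := (hA.valence_subset_range _ hy).choose_spec
  have hmem (s : Finset (Fin n)) : v ∈ (A.system t k).valence
      (A.scheduledInitial (s.piecewise (fun _ => w) (fun _ => v))) := by
    induction s using Finset.induction_on with
    | empty =>
      obtain ⟨v', hv', -⟩ := hA.linked_of_similar (F := ∅) (input := fun _ => v) htn .refl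
        (.refl ∅ _) (Nat.zero_le t)
      rw [Finset.piecewise_empty]
      exact hconst hv' ▸ hv'
    | insert i s _ ih =>
      rw [Finset.piecewise_insert]
      exact (hA.linked_scheduledInitial_update ht htn _ i w).valence_subset (hfixed _) ih
  have hv := hmem Finset.univ
  rw [Finset.piecewise_univ] at hv
  exact hvw (hconst hv).symm

theorem not_valence_nontrivial (ht : 1 ≤ t) (htn : t < n) (hkt : n ≤ t + k) (input : Fin n → V) :
    ¬ ((A.system t k).valence (A.scheduledInitial input)).Nontrivial := by
  intro hval
  have : Nonempty (Fin n) := ⟨⟨0, by omega⟩⟩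
  obtain ⟨f, l, h0, hf, hbi⟩ := DecisionSystem.exists_isFairPath_valence_nontrivial
    (fun p σ τ l hσ hl hmove => hA.linked_step_of_move ht htn hkt hσ hl hmove) hval
  obtain ⟨c, e, hrun, hdec⟩ := exists_isRun_of_reaches hA.one_shot hf (Nat.zero_le t)
    (by rw [h0]; exact .refl)
  obtain ⟨v, hv⟩ := hA.termination input c e ∅ hrun ⟨0, by omega⟩ (Finset.notMem_empty _)
  obtain ⟨s, hs⟩ := (hdec _ v).1 hv
  have hempty := hA.decided_eq_empty (h0 ▸ hf.reaches s.zero_le) (hbi s)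
  exact hempty.subset (Set.mem_iUnion.2 ⟨_, hs⟩)

end ImplementsConsensus

end Consensus

end Algorithm

end CrashModel

theorem mainTheorem3_general (n t k : ℕ) (ht : 1 ≤ t) (htn : t < n) (hkt : n ≤ t + k)
    (V R W O U S : Type*) [Nontrivial V] :
    ¬ ∃ A : CrashModel.Algorithm n V R W O U S, A.ImplementsConsensus t k := by
  rintro ⟨A, hA⟩
  obtain ⟨input, hval⟩ := hA.exists_valence_nontrivial ht htn
  exact hA.not_valence_nontrivial ht htn hkt input hval

theorem mainTheorem3 (n t k : ℕ) (hnt : n ≤ 2 * t) (htk : t ≤ k) (hkn : k < n - 1)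
    (V R W O U S : Type*) [Nontrivial V] :
    ¬ ∃ A : CrashModel.Algorithm n V R W O U S, A.ImplementsConsensus t k :=
  mainTheorem3_general n t k (by omega) (by omega) (by omega) V R W O U S
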